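/- Let $k$ be a field, let $m,n\ge 1$ be integers, and let $S=k[x_1,\ldots,x_m,y_1,\ldots,y_n]$ with the standard grading. Let $$I_{n,1^{m-1}}=(x_1y_1,x_1y_2,\ldots,x_1y_n,x_2y_1,x_3y_1,\ldots,x_my_1)\subset S$$ be the Ferrers ideal of the tableau $(n,1,\ldots,1)$ with $m$ rows. Then the Hilbert series $\sum_{d\ge0}\dim_k (S/I_{n,1^{m-1}})_d\,t^d$ of $S/I_{n,1^{m-1}}$ is $$\frac{1}{(1-t)^n}+\frac{1}{(1-t)^m}+\frac{1}{(1-t)^{m+n-2}}-\frac{1}{(1-t)^{n-1}}-\frac{1}{(1-t)^{m-1}}.$$ Moreover, for all $i\ge 1$ the Betti number $\beta_i=\dim_k\mathrm{Tor}^S_i(S/I_{n,1^{m-1}},k)$ is finite and equals $$\beta_i=\binom{n+1}{i+1}+\binom{m+1}{i+1}-\binom{n}{i+1}-\binom{m}{i+1}-\binom{2}{i+1},$$ and these are the graded Betti numbers of a $2$-linear resolution: $S/I_{n,1^{m-1}}$ has a minimal graded free resolution $0\leftarrow S/I_{n,1^{m-1}}\leftarrow F_0\leftarrow F_1\leftarrow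 F_2\leftarrow\cdots$ with $F_0= S$ and $F_i= S[-i-1]^{\beta_i}$ for all $i\ge1$ (that is, $\beta_{i,i+1}=\beta_i$ and $\beta_{i,j}=0$ for $j\neq i+1$, $i\ge 1$). -/

import Mathlib

universe u

/-- The Ferrers ideal of the tableau `lam = (lam_1, …, lam_m)` (all `lam_i ≤ n`) in
`k[x_1, …, x_m, y_1, …, y_n]`: it is generated by the `x_i y_j` with `1 ≤ j ≤ lam_i`.
The variable `x_i` is `X (Sum.inl (i - 1))` and `y_j` is `X (Sum.inr (j - 1))`. -/
noncomputable def ferrersIdeal (k : Type u) [Field k] {m : ℕ} (n : ℕ) (lam : Fin m → ℕ) :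
    Ideal (MvPolynomial (Fin m ⊕ Fin n) k) :=
  Ideal.span {p | ∃ (i : Fin m) (j : Fin n), j.val < lam i ∧
    p = MvPolynomial.X (Sum.inl i) * MvPolynomial.X (Sum.inr j)}

/-- The tableau `(n, 1^{m-1}) = (n, 1, …, 1)`, with `m` rows. -/
def hookTableau (m n : ℕ) : Fin m → ℕ := fun i => if i.val = 0 then n else 1

section GradedInvariants

variable {σ : Type} {k : Type u} [Field k]

/-- The degree `d` part of `S / I`, for `S = k[σ]` with the standard grading and `I` homogeneous:
the image of the space of homogeneous polynomials of degree `d`. -/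
noncomputable def quotientPiece (I : Ideal (MvPolynomial σ k)) (d : ℕ) :
    Submodule k (MvPolynomial σ k ⧸ I) :=
  (MvPolynomial.homogeneousSubmodule σ k d).map (Ideal.Quotient.mkₐ k I).toLinearMap

/-- The Hilbert series `∑_d dim_k (S / I)_d t^d` of `S / I`, as a formal power series. -/
noncomputable def hilbertSeries (I : Ideal (MvPolynomial σ k)) : PowerSeries ℚ :=
  PowerSeries.mk fun d => (Module.finrank k (quotientPiece I d) : ℚ)

/-- The residue field `k = S / (variables)`, as a module over `S = k[σ]`. -/
noncomputable def residueModule (σ : Type) (k : Type u) [Field k] :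
    ModuleCat.{u} (MvPolynomial σ k) :=
  ModuleCat.of (MvPolynomial σ k)
    (MvPolynomial σ k ⧸
      Ideal.span (Set.range (MvPolynomial.X : σ → MvPolynomial σ k)))

/-- `Tor_i^S(S / I, k)` as a vector space over `k`, where `S = k[σ]`; this is the `i`-th left
derived functor of `- ⊗ k`, evaluated at `S / I`. -/
noncomputable def torSpace (I : Ideal (MvPolynomial σ k)) (i : ℕ) : ModuleCat.{u} k :=
  (ModuleCat.restrictScalars (algebraMap k (MvPolynomial σ k))).obj
    (((CategoryTheory.Tor' (ModuleCat.{u} (MvPolynomial σ k)) i).obj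
      (ModuleCat.of (MvPolynomial σ k) (MvPolynomial σ k ⧸ I))).obj (residueModule σ k))

/-- The Betti number `β_i(S / I) = dim_k Tor_i^S(S / I, k)`. -/
noncomputable def bettiNumber (I : Ideal (MvPolynomial σ k)) (i : ℕ) : ℕ :=
  Module.finrank k (torSpace I i)

/-- A minimal graded free resolution
`0 ← S / I ← F_0 ← F_1 ← ⋯` of `S / I` over `S = k[σ]`, with homogeneous bases of finite size:
`F_i = ⨁_p S[-deg i p]`, where `p` runs over the `rank i` basis elements of `F_i`. -/
structure MinimalGradedFreeResolution (I : Ideal (MvPolynomial σ k)) where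
  /-- the rank of `F_i` -/
  rank : ℕ → ℕ
  /-- the degrees of the basis elements of `F_i` -/
  deg : (i : ℕ) → Fin (rank i) → ℕ
  /-- the augmentation `F_0 → S / I` -/
  aug : (Fin (rank 0) → MvPolynomial σ k) →ₗ[MvPolynomial σ k] (MvPolynomial σ k ⧸ I)
  /-- the differential `F_{i+1} → F_i` -/
  diff : (i : ℕ) → (Fin (rank (i + 1)) → MvPolynomial σ k) →ₗ[MvPolynomial σ k]
    (Fin (rank i) → MvPolynomial σ k)
  /-- the augmentation has degree `0` -/
  aug_homogeneous : ∀ p, aug (Pi.single p 1) ∈ quotientPiece I (deg 0 p)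
  /-- the differentials have degree `0`: the `(p, q)` entry of the matrix is homogeneous of
  degree `deg q - deg p`, and zero if this is negative -/
  diff_homogeneous : ∀ i q p, diff i (Pi.single q 1) p = 0 ∨
    ∃ e, deg i p + e = deg (i + 1) q ∧ (diff i (Pi.single q 1) p).IsHomogeneous e
  /-- exactness at `S / I` -/
  aug_surjective : Function.Surjective aug
  /-- exactness at `F_0` -/
  exact_zero : Function.Exact (diff 0) aug
  /-- exactness at `F_{i+1}` -/
  exact_succ : ∀ i, Function.Exact (diff (i + 1)) (diff i)
  /-- minimality: the entries of the differentials lie in the ideal of the variables -/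
  minimal : ∀ i q p, MvPolynomial.constantCoeff (diff i (Pi.single q 1) p) = 0

/-- The graded Betti number `β_{i,j}` read off from a minimal graded free resolution: the number
of summands `S[-j]` in `F_i`. -/
def MinimalGradedFreeResolution.gradedBetti {I : Ideal (MvPolynomial σ k)}
    (F : MinimalGradedFreeResolution I) (i j : ℕ) : ℕ :=
  (Finset.univ.filter fun p => F.deg i p = j).card

end GradedInvariants

/-! Put J = (y_2, …, y_n) and K = (x_2, …, x_m). The hook ideal is I = x_1 (J + (y_1)) + y_1 (K +
(x_1)), and the two summands meet exactly in (x_1 y_1). Up to a shift each summand is an ideal of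
variables, so it is resolved by a truncated Koszul complex, obtained by iterating
`LinearResolution.cone`. The two complexes share one generator: y_1 in the first and x_1 in the
second both give x_1 y_1. Identifying these two basis elements glues the complexes into a resolution
of I (`LinearResolution.hook`), of rank binom(n, i) + binom(m, i) in homological degree i ≥ 1, less
one for i = 1. Pascal's rule turns this into the stated formula, where binom(2, i + 1) accounts for
the shared generator.

The generators are quadrics and all later matrices consist of linear forms, so the resolution is
2-linear and minimal. Minimality makes every differential vanish after tensoring with k; hence Tor_i
is k to the rank of F_i (`MinimalGradedFreeResolution.torSpace_equiv`).

The Hilbert series is found independently of the resolution, by counting monomials outside I. Such a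
monomial avoids both x_1 and y_1, or contains x_1 and then no y_j, or contains y_1 and then no x_i
(`hilbertSeries_hook`). -/

/-! ### Projective resolutions from exact sequences, and their derived functors -/

section ExactComplex

open CategoryTheory

variable {R : Type u} [CommRing R] {Z : Type u} [AddCommGroup Z] [Module R Z]
  (N : ℕ → Type u) [∀ i, AddCommGroup (N i)] [∀ i, Module R (N i)]
  (d : ∀ i, N (i + 1) →ₗ[R] N i)

/-- The chain complex of modules with differentials `d`. -/
noncomputable def complexOfExact (hd : ∀ i, Function.Exact (d (i + 1)) (d i)) :
    ChainComplex (ModuleCat.{u} R) ℕ :=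
  ChainComplex.of (fun i => ModuleCat.of R (N i)) (fun i => ModuleCat.ofHom (d i))
    (fun i => by ext x; exact (hd i).apply_apply_eq_zero x)

theorem complexOfExact_d (hd : ∀ i, Function.Exact (d (i + 1)) (d i)) (i : ℕ) :
    (complexOfExact N d hd).d (i + 1) i = ModuleCat.ofHom (d i) :=
  ChainComplex.of_d (fun i => ModuleCat.of R (N i)) (fun i => ModuleCat.ofHom (d i)) i

theorem complexOfExact_exact (hd : ∀ i, Function.Exact (d (i + 1)) (d i)) (n : ℕ) :
    (complexOfExact N d hd).ExactAt (n + 1) := by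
  rw [HomologicalComplex.exactAt_iff' _ (n + 2) (n + 1) n (by simp) (by simp),
    ShortComplex.moduleCat_exact_iff]
  intro x hx
  change (complexOfExact N d hd).d (n + 1) n x = 0 at hx
  change ∃ y, (complexOfExact N d hd).d (n + 2) (n + 1) y = x
  rw [complexOfExact_d] at hx
  rw [complexOfExact_d]
  exact (hd n x).1 hx

/-- The augmentation of `complexOfExact`, as a morphism in `ModuleCat`. -/
noncomputable def complexOfExactAug (hd : ∀ i, Function.Exact (d (i + 1)) (d i))
    (ε : N 0 →ₗ[R] Z) : (complexOfExact N d hd).X 0 ⟶ ModuleCat.of R Z :=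
  ModuleCat.ofHom ε

theorem complexOfExact_d_comp_aug (hd : ∀ i, Function.Exact (d (i + 1)) (d i))
    (ε : N 0 →ₗ[R] Z) (h0 : Function.Exact (d 0) ε) :
    (complexOfExact N d hd).d 1 0 ≫ complexOfExactAug N d hd ε = 0 := by
  rw [complexOfExact_d]
  ext x; exact h0.apply_apply_eq_zero x

/-- The augmentation of `complexOfExact`, as a morphism of complexes. -/
noncomputable def complexOfExactπ (hd : ∀ i, Function.Exact (d (i + 1)) (d i))
    (ε : N 0 →ₗ[R] Z) (h0 : Function.Exact (d 0) ε) :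
    complexOfExact N d hd ⟶ (ChainComplex.single₀ _).obj (ModuleCat.of R Z) :=
  (ChainComplex.toSingle₀Equiv _ _).symm
    ⟨complexOfExactAug N d hd ε, complexOfExact_d_comp_aug N d hd ε h0⟩

theorem complexOfExactπ_f_zero (hd : ∀ i, Function.Exact (d (i + 1)) (d i))
    (ε : N 0 →ₗ[R] Z) (h0 : Function.Exact (d 0) ε) :
    (complexOfExactπ N d hd ε h0).f 0 = complexOfExactAug N d hd ε :=
  ChainComplex.toSingle₀Equiv_symm_apply_f_zero _ _

/-- An exact sequence `0 ← Z ← N 0 ← N 1 ← ⋯` with projective `N i` is a projective resolution. -/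
noncomputable def projectiveResolutionOfExact [∀ i, Module.Projective R (N i)]
    (ε : N 0 →ₗ[R] Z) (hε : Function.Surjective ε)
    (h0 : Function.Exact (d 0) ε) (hd : ∀ i, Function.Exact (d (i + 1)) (d i)) :
    ProjectiveResolution (ModuleCat.of R Z) where
  complex := complexOfExact N d hd
  projective n := inferInstanceAs (Projective (ModuleCat.of R (N n)))
  π := complexOfExactπ N d hd ε h0
  quasiIso := ⟨fun n => by
    cases n with
    | zero =>
      -- In degree 0 a quasi-isomorphism onto Z means exactness at `N 0` together with surjectivity
      -- of the augmentation.
      rw [ChainComplex.quasiIsoAt₀_iff, ShortComplex.quasiIso_iff_of_zeros' _ rfl rfl rfl]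
      constructor
      · rw [ShortComplex.moduleCat_exact_iff]
        intro x hx
        change (complexOfExactπ N d hd ε h0).f 0 x = 0 at hx
        rw [complexOfExactπ_f_zero] at hx
        change ∃ y, (complexOfExact N d hd).d 1 0 y = x
        rw [complexOfExact_d]
        exact (h0 x).1 hx
      · change Epi ((complexOfExactπ N d hd ε h0).f 0)
        rw [complexOfExactπ_f_zero]
        exact (ModuleCat.epi_iff_surjective _).2 hε
    | succ n =>
      rw [quasiIsoAt_iff_exactAt' (hL := ChainComplex.exactAt_succ_single_obj ..)]
      exact complexOfExact_exact N d hd n⟩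

/-- If `G` kills the differentials of a projective resolution built from `N` then the left derived
functors of `G` are the `G (N i)`. -/
theorem leftDerived_iso_of_map_eq_zero [∀ i, Module.Projective R (N i)]
    (ε : N 0 →ₗ[R] Z) (hε : Function.Surjective ε)
    (h0 : Function.Exact (d 0) ε) (hd : ∀ i, Function.Exact (d (i + 1)) (d i))
    (G : ModuleCat.{u} R ⥤ ModuleCat.{u} R) [G.Additive]
    (hG : ∀ i, G.map (ModuleCat.ofHom (d i)) = 0) (i : ℕ) :
    Nonempty ((G.leftDerived i).obj (ModuleCat.of R Z) ≅ G.obj (ModuleCat.of R (N i))) := by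
  -- A complex with zero differentials is its own homology.
  have hz : ∀ a b, ((G.mapHomologicalComplex (ComplexShape.down ℕ)).obj
      (complexOfExact N d hd)).d a b = 0 := by
    intro a b
    by_cases hab : b + 1 = a
    · subst hab
      change G.map ((complexOfExact N d hd).d (b + 1) b) = 0
      rw [complexOfExact_d]
      exact hG b
    · exact HomologicalComplex.shape _ _ _ hab
  refine ⟨(projectiveResolutionOfExact N d ε hε h0 hd).isoLeftDerivedObj G i ≪≫ ?_⟩
  exact (ShortComplex.HomologyData.ofZeros
    (((G.mapHomologicalComplex (ComplexShape.down ℕ)).obj (complexOfExact N d hd)).sc i)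
    (hz _ _) (hz _ _)).left.homologyIso

end ExactComplex

/-! ### Tor with the residue field, computed from a minimal resolution -/

section ResidueField

open CategoryTheory TensorProduct

variable {σ : Type} {k : Type u} [Field k]

theorem MvPolynomial.mem_span_range_X_iff {p : MvPolynomial σ k} :
    p ∈ Ideal.span (Set.range (MvPolynomial.X : σ → MvPolynomial σ k)) ↔
      MvPolynomial.constantCoeff p = 0 := by
  rw [← Set.image_univ, MvPolynomial.mem_ideal_span_X_image, MvPolynomial.constantCoeff_eq]
  constructor
  · intro h
    by_contra h0
    obtain ⟨i, -, hi⟩ := h 0 (MvPolynomial.mem_support_iff.2 h0)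
    exact hi rfl
  · intro h m hm
    by_contra! h0
    have : m = 0 := Finsupp.ext fun i => h0 i trivial
    exact MvPolynomial.mem_support_iff.1 hm (this ▸ h)

/-- The residue field of `k[σ]` at the ideal of the variables is `k`. -/
noncomputable def residueEquiv (σ : Type) (k : Type u) [Field k] :
    (MvPolynomial σ k ⧸ Ideal.span (Set.range (MvPolynomial.X : σ → MvPolynomial σ k)))
      ≃ₐ[k] k :=
  AlgEquiv.ofBijective
    (Ideal.Quotient.liftₐ _ (MvPolynomial.aeval (0 : σ → k)) fun p hp => by
      rw [MvPolynomial.aeval_zero, MvPolynomial.mem_span_range_X_iff.1 hp, map_zero])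
    ⟨by
      rw [injective_iff_map_eq_zero]
      intro x hx
      obtain ⟨p, rfl⟩ := Ideal.Quotient.mk_surjective x
      change MvPolynomial.aeval (0 : σ → k) p = 0 at hx
      rw [Ideal.Quotient.eq_zero_iff_mem, MvPolynomial.mem_span_range_X_iff]
      simpa [MvPolynomial.aeval_zero] using hx,
    fun c => ⟨algebraMap k _ c, by simp⟩⟩

/-- `S^r ⊗ k` has dimension `r` over `k`. -/
theorem restrictScalars_tensor_residue (r : ℕ) :
    Nonempty (((ModuleCat.restrictScalars (algebraMap k (MvPolynomial σ k))).obj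
      (((MonoidalCategory.tensoringRight (ModuleCat.{u} (MvPolynomial σ k))).obj
        (residueModule σ k)).obj (ModuleCat.of _ (Fin r → MvPolynomial σ k)))) ≃ₗ[k]
          (Fin r → k)) := by
  let e : TensorProduct (MvPolynomial σ k) (Fin r → MvPolynomial σ k) (MvPolynomial σ k ⧸
      Ideal.span (Set.range (MvPolynomial.X : σ → MvPolynomial σ k))) ≃ₗ[MvPolynomial σ k]
        (Fin r → (MvPolynomial σ k ⧸
      Ideal.span (Set.range (MvPolynomial.X : σ → MvPolynomial σ k)))) :=
    TensorProduct.comm _ _ _ ≪≫ₗ TensorProduct.piScalarRight _ (MvPolynomial σ k) _ _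
  -- `e` is linear over S but `residueEquiv` only over k, so linearity of the composite is checked
  -- by hand through `algebraMap`.
  refine ⟨{ toFun := fun x p => residueEquiv σ k (e x p)
            invFun := fun y => e.symm (fun p => (residueEquiv σ k).symm (y p))
            left_inv := ?_
            right_inv := ?_
            map_add' := ?_
            map_smul' := ?_}⟩
  · intro x y
    funext p
    exact (congrArg (fun z => residueEquiv σ k (z p)) (e.map_add x y)).trans
      (map_add (residueEquiv σ k) _ _)
  · intro c x
    funext p
    refine (congrArg (fun z => residueEquiv σ k (z p))
      (e.map_smul (algebraMap k (MvPolynomial σ k) c) x)).trans ?_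
    rw [Pi.smul_apply, algebraMap_smul, map_smul]
    rfl
  · intro x
    simp only [AlgEquiv.symm_apply_apply]
    exact e.symm_apply_apply x
  · intro y
    simp

/-- This is where minimality is used: matrix entries without constant term annihilate the residue
field, and they can be moved across the tensor product onto it. -/
theorem tensor_residue_map_eq_zero {r s : ℕ}
    (f : (Fin r → MvPolynomial σ k) →ₗ[MvPolynomial σ k] (Fin s → MvPolynomial σ k))
    (hf : ∀ q p, MvPolynomial.constantCoeff (f (Pi.single q 1) p) = 0) :
    ((MonoidalCategory.tensoringRight (ModuleCat.{u} (MvPolynomial σ k))).obj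
        (residueModule σ k)).map (ModuleCat.ofHom f) = 0 := by
  apply ModuleCat.hom_ext
  refine TensorProduct.ext' fun v z => ?_
  change f v ⊗ₜ[MvPolynomial σ k] z = 0
  have hc : ∀ p, MvPolynomial.constantCoeff (f v p) = 0 := fun p => by
    conv_lhs => rw [pi_eq_sum_univ' v]
    simp [map_sum, Finset.sum_apply, hf]
  rw [pi_eq_sum_univ' (f v), TensorProduct.sum_tmul]
  refine Finset.sum_eq_zero fun p _ => ?_
  have hz : f v p • z = 0 := by
    obtain ⟨q, rfl⟩ := Ideal.Quotient.mk_surjective z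
    change Ideal.Quotient.mk (Ideal.span (Set.range MvPolynomial.X)) (f v p * q) = 0
    rw [Ideal.Quotient.eq_zero_iff_mem]
    exact Ideal.mul_mem_right _ _ (MvPolynomial.mem_span_range_X_iff.2 (hc p))
  rw [TensorProduct.smul_tmul, hz, TensorProduct.tmul_zero]

theorem MinimalGradedFreeResolution.torSpace_equiv {I : Ideal (MvPolynomial σ k)}
    (F : MinimalGradedFreeResolution I) (i : ℕ) :
    Nonempty (torSpace I i ≃ₗ[k] (Fin (F.rank i) → k)) := by
  obtain ⟨e⟩ := leftDerived_iso_of_map_eq_zero (fun i => Fin (F.rank i) → MvPolynomial σ k)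
    F.diff F.aug F.aug_surjective F.exact_zero F.exact_succ
    ((MonoidalCategory.tensoringRight (ModuleCat.{u} (MvPolynomial σ k))).obj (residueModule σ k))
    (fun i => tensor_residue_map_eq_zero (F.diff i) (F.minimal i)) i
  obtain ⟨e'⟩ := restrictScalars_tensor_residue (σ := σ) (k := k) (F.rank i)
  exact ⟨((ModuleCat.restrictScalars (algebraMap k (MvPolynomial σ k))).mapIso e).toLinearEquiv ≪≫ₗ
    e'⟩

theorem MinimalGradedFreeResolution.finite_torSpace {I : Ideal (MvPolynomial σ k)}
    (F : MinimalGradedFreeResolution I) (i : ℕ) : Module.Finite k (torSpace I i) := by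
  obtain ⟨e⟩ := F.torSpace_equiv i
  exact Module.Finite.equiv e.symm

theorem MinimalGradedFreeResolution.bettiNumber_eq {I : Ideal (MvPolynomial σ k)}
    (F : MinimalGradedFreeResolution I) (i : ℕ) : bettiNumber I i = F.rank i := by
  obtain ⟨e⟩ := F.torSpace_equiv i
  rw [bettiNumber, e.finrank_eq, Module.finrank_fin_fun]

end ResidueField

/-! ### Linear resolutions given by matrices -/

section LinearResolution

open Matrix

variable {σ : Type} {k : Type u} [Field k]

/-- A resolution `0 ← S / J ← S ← S^{r 0} ← S^{r 1} ← ⋯` over `S = k[σ]` given by matrices: the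
entries of the first one have degree `e`, those of the others are linear forms. -/
structure LinearResolution (J : Ideal (MvPolynomial σ k)) (e : ℕ) (r : ℕ → ℕ) where
  /-- the index set of the basis in homological degree `i + 1` -/
  ι : ℕ → Type
  [fintype : ∀ i, Fintype (ι i)]
  [decidableEq : ∀ i, DecidableEq (ι i)]
  card_ι : ∀ i, Fintype.card (ι i) = r i
  /-- the generators of `J` -/
  ε : ι 0 → MvPolynomial σ k
  /-- the matrices of the higher differentials -/
  d : ∀ i, Matrix (ι i) (ι (i + 1)) (MvPolynomial σ k)
  ε_homogeneous : ∀ p, (ε p).IsHomogeneous e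
  d_homogeneous : ∀ i p q, (d i p q).IsHomogeneous 1
  mem_iff : ∀ f, f ∈ J ↔ ∃ v, ε ⬝ᵥ v = f
  exact_zero : ∀ v, ε ⬝ᵥ v = 0 ↔ ∃ w, d 0 *ᵥ w = v
  exact_succ : ∀ i v, d i *ᵥ v = 0 ↔ ∃ w, d (i + 1) *ᵥ w = v

namespace LinearResolution

theorem exists_eq_sumElim {α β γ : Type*} (v : α ⊕ β → γ) : ∃ a b, v = Sum.elim a b :=
  ⟨_, _, (Sum.elim_comp_inl_inr v).symm⟩

attribute [instance] fintype decidableEq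

variable {J : Ideal (MvPolynomial σ k)} {e : ℕ} {r : ℕ → ℕ}

theorem ε_d (A : LinearResolution J e r) (w) : A.ε ⬝ᵥ (A.d 0 *ᵥ w) = 0 :=
  (A.exact_zero _).2 ⟨w, rfl⟩

theorem d_d (A : LinearResolution J e r) (i : ℕ) (w) : A.d i *ᵥ (A.d (i + 1) *ᵥ w) = 0 :=
  (A.exact_succ i _).2 ⟨w, rfl⟩

/-! ### Mapping cones and the Koszul resolution -/

/-- The index sets of the mapping cone. -/
def coneIndex (ι : ℕ → Type) : ℕ → Type
  | 0 => ι 0 ⊕ Unit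
  | i + 1 => ι (i + 1) ⊕ ι i

instance (ι : ℕ → Type) [∀ i, Fintype (ι i)] : ∀ i, Fintype (coneIndex ι i)
  | 0 => inferInstanceAs (Fintype (ι 0 ⊕ Unit))
  | i + 1 => inferInstanceAs (Fintype (ι (i + 1) ⊕ ι i))

instance (ι : ℕ → Type) [∀ i, DecidableEq (ι i)] : ∀ i, DecidableEq (coneIndex ι i)
  | 0 => inferInstanceAs (DecidableEq (ι 0 ⊕ Unit))
  | i + 1 => inferInstanceAs (DecidableEq (ι (i + 1) ⊕ ι i))

/-- The differentials of the mapping cone of multiplication by `y`. -/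
noncomputable def coneD (A : LinearResolution J e r) (y : MvPolynomial σ k) :
    ∀ i, Matrix (coneIndex A.ι i) (coneIndex A.ι (i + 1)) (MvPolynomial σ k)
  | 0 => (fromBlocks (A.d 0) (y • (1 : Matrix (A.ι 0) (A.ι 0) _)) 0 (of fun _ q => - A.ε q) :
      Matrix (A.ι 0 ⊕ Unit) (A.ι 1 ⊕ A.ι 0) _)
  -- The sign in the last block makes the two contributions of y to a composite of consecutive
  -- matrices cancel.
  | i + 1 => (fromBlocks (A.d (i + 1)) (y • (1 : Matrix (A.ι (i + 1)) (A.ι (i + 1)) _)) 0 (-A.d i) :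
      Matrix (A.ι (i + 1) ⊕ A.ι i) (A.ι (i + 2) ⊕ A.ι (i + 1)) _)

theorem coneD_zero_mulVec (A : LinearResolution J e r) (y : MvPolynomial σ k)
    (a : A.ι 1 → MvPolynomial σ k) (b : A.ι 0 → MvPolynomial σ k) :
    (A.coneD y 0 *ᵥ (Sum.elim a b : A.ι 1 ⊕ A.ι 0 → _) : A.ι 0 ⊕ Unit → _) =
      Sum.elim (A.d 0 *ᵥ a + y • b) (fun _ => - (A.ε ⬝ᵥ b)) := by
  refine (fromBlocks_mulVec _ _ _ _ _).trans ?_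
  congr 1
  · simp [smul_mulVec]
  · funext u
    simp [mulVec, dotProduct]

theorem coneD_succ_mulVec (A : LinearResolution J e r) (y : MvPolynomial σ k) (i : ℕ)
    (a : A.ι (i + 2) → MvPolynomial σ k) (b : A.ι (i + 1) → MvPolynomial σ k) :
    (A.coneD y (i + 1) *ᵥ (Sum.elim a b : A.ι (i + 2) ⊕ A.ι (i + 1) → _) :
      A.ι (i + 1) ⊕ A.ι i → _) =
      Sum.elim (A.d (i + 1) *ᵥ a + y • b) (- (A.d i *ᵥ b)) := by
  refine (fromBlocks_mulVec _ _ _ _ _).trans ?_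
  congr 1
  · simp [smul_mulVec]
  · simp [neg_mulVec]

theorem coneε_dotProduct (A : LinearResolution J e r) (y : MvPolynomial σ k)
    (a : A.ι 0 → MvPolynomial σ k) (s : Unit → MvPolynomial σ k) :
    (Sum.elim A.ε (fun _ => y) : A.ι 0 ⊕ Unit → _) ⬝ᵥ (Sum.elim a s) =
      A.ε ⬝ᵥ a + y * s () := by
  simp [dotProduct]

/-- If `y` is a nonzerodivisor modulo `J`, then the mapping cone of multiplication by `y` resolves
`S / (J, y)`. -/
noncomputable def cone {p : ℕ} (A : LinearResolution J 1 (fun i => p.choose (i + 1)))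
    (y : MvPolynomial σ k) (hy : y.IsHomogeneous 1) (hJ : ∀ f, y * f ∈ J → f ∈ J) :
    LinearResolution (J ⊔ Ideal.span {y}) 1 (fun i => (p + 1).choose (i + 1)) where
  ι := coneIndex A.ι
  card_ι i := by
    cases i with
    | zero =>
      refine Fintype.card_sum.trans ?_
      rw [A.card_ι]
      simp
    | succ i =>
      refine Fintype.card_sum.trans ?_
      rw [A.card_ι, A.card_ι, add_comm]
      exact (Nat.choose_succ_succ p (i + 1)).symm
  ε := (Sum.elim A.ε (fun _ => y) : A.ι 0 ⊕ Unit → _)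
  d := A.coneD y
  ε_homogeneous := by
    rintro (p | p)
    · exact A.ε_homogeneous p
    · exact hy
  d_homogeneous i := by
    have hy1 : ∀ {α : Type} [DecidableEq α] (p q : α),
        ((y • (1 : Matrix α α (MvPolynomial σ k))) p q).IsHomogeneous 1 := by
      intro α _ p q
      rw [Matrix.smul_apply, one_apply]
      split_ifs
      · simpa using hy
      · simpa using MvPolynomial.isHomogeneous_zero _ _ _
    cases i with
    | zero =>
      rintro (p | p) (q | q)
      · exact A.d_homogeneous _ _ _
      · exact hy1 _ _
      · exact MvPolynomial.isHomogeneous_zero _ _ _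
      · exact (A.ε_homogeneous _).neg
    | succ i =>
      rintro (p | p) (q | q)
      · exact A.d_homogeneous _ _ _
      · exact hy1 _ _
      · exact MvPolynomial.isHomogeneous_zero _ _ _
      · exact (A.d_homogeneous _ _ _).neg
  mem_iff f := by
    rw [Submodule.mem_sup]
    constructor
    · rintro ⟨g, hg, h, hh, rfl⟩
      obtain ⟨a, rfl⟩ := (A.mem_iff g).1 hg
      obtain ⟨c, rfl⟩ := Ideal.mem_span_singleton.1 hh
      exact ⟨(Sum.elim a (fun _ => c) : A.ι 0 ⊕ Unit → _), A.coneε_dotProduct y _ _⟩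
    · rintro ⟨v, rfl⟩
      rw [← Sum.elim_comp_inl_inr (v : A.ι 0 ⊕ Unit → _)]
      exact ⟨_, (A.mem_iff _).2 ⟨_, rfl⟩, _, Ideal.mem_span_singleton.2 (dvd_mul_right _ _),
        (A.coneε_dotProduct y _ _).symm⟩
  exact_zero v := by
    constructor
    · obtain ⟨a, s, rfl⟩ := exists_eq_sumElim (v : A.ι 0 ⊕ Unit → _)
      intro h
      replace h := (A.coneε_dotProduct y a s).symm.trans h
      -- The relation gives y s ∈ J, so s = ε · b by the nonzerodivisor hypothesis. Then a + y b is
      -- a syzygy of ε, say d c, and (c, -b) maps to (a, s).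
      have hs : s () ∈ J := hJ _ ((A.mem_iff _).2 ⟨-a, by rw [dotProduct_neg]; linear_combination -h⟩)
      obtain ⟨b, hb⟩ := (A.mem_iff _).1 hs
      obtain ⟨c, hc⟩ := (A.exact_zero (a + y • b)).1 (by
        rw [dotProduct_add, dotProduct_smul, hb, smul_eq_mul, h])
      refine ⟨(Sum.elim c (-b) : A.ι 1 ⊕ A.ι 0 → _), (A.coneD_zero_mulVec y c (-b)).trans ?_⟩
      congr 1
      · rw [hc]; simp
      · funext u
        rw [dotProduct_neg, neg_neg, hb]
    · rintro ⟨w, rfl⟩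
      obtain ⟨a, b, rfl⟩ := exists_eq_sumElim (w : A.ι 1 ⊕ A.ι 0 → _)
      refine (congrArg _ (A.coneD_zero_mulVec y a b)).trans ((A.coneε_dotProduct y _ _).trans ?_)
      rw [dotProduct_add, A.ε_d, dotProduct_smul, smul_eq_mul]
      ring
  exact_succ i v := by
    cases i with
    | zero =>
      obtain ⟨a, b, rfl⟩ := exists_eq_sumElim (v : A.ι 1 ⊕ A.ι 0 → _)
      constructor
      · intro h
        replace h := (A.coneD_zero_mulVec y a b).symm.trans h
        have h1 : A.d 0 *ᵥ a + y • b = 0 := funext fun p => congrFun h (Sum.inl p)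
        have h2 : A.ε ⬝ᵥ b = 0 := neg_eq_zero.1 (congrFun h (Sum.inr ()))
        -- The same chase in each higher degree: lift b to c, correct a by y c, and lift the result.
        obtain ⟨c, rfl⟩ := (A.exact_zero b).1 h2
        obtain ⟨c', hc'⟩ := (A.exact_succ 0 (a + y • c)).1 (by rw [mulVec_add, mulVec_smul, h1])
        refine ⟨(Sum.elim c' (-c) : A.ι 2 ⊕ A.ι 1 → _), (A.coneD_succ_mulVec y 0 c' (-c)).trans ?_⟩
        congr 1
        · rw [hc']; simp
        · rw [mulVec_neg, neg_neg]
      · rintro ⟨w, hw⟩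
        obtain ⟨c, c', rfl⟩ := exists_eq_sumElim (w : A.ι 2 ⊕ A.ι 1 → _)
        rw [← hw]
        refine (congrArg _ (A.coneD_succ_mulVec y 0 _ _)).trans ((A.coneD_zero_mulVec y _ _).trans ?_)
        funext p
        obtain p | p := p
        · simp [mulVec_add, A.d_d, mulVec_smul]
          rfl
        · simp [A.ε_d]
          rfl
    | succ i =>
      obtain ⟨a, b, rfl⟩ := exists_eq_sumElim (v : A.ι (i + 2) ⊕ A.ι (i + 1) → _)
      constructor
      · intro h
        replace h := (A.coneD_succ_mulVec y i a b).symm.trans h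
        have h1 : A.d (i + 1) *ᵥ a + y • b = 0 := funext fun p => congrFun h (Sum.inl p)
        have h2 : A.d i *ᵥ b = 0 := neg_eq_zero.1 (funext fun p => congrFun h (Sum.inr p))
        obtain ⟨c, rfl⟩ := (A.exact_succ i b).1 h2
        obtain ⟨c', hc'⟩ := (A.exact_succ (i + 1) (a + y • c)).1 (by
          rw [mulVec_add, mulVec_smul, h1])
        refine ⟨(Sum.elim c' (-c) : A.ι (i + 3) ⊕ A.ι (i + 2) → _),
          (A.coneD_succ_mulVec y (i + 1) c' (-c)).trans ?_⟩
        congr 1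
        · rw [hc']; simp
        · rw [mulVec_neg, neg_neg]
      · rintro ⟨w, hw⟩
        obtain ⟨c, c', rfl⟩ := exists_eq_sumElim (w : A.ι (i + 3) ⊕ A.ι (i + 2) → _)
        rw [← hw]
        refine (congrArg _ (A.coneD_succ_mulVec y (i + 1) _ _)).trans
          ((A.coneD_succ_mulVec y i _ _).trans ?_)
        funext p
        obtain p | p := p
        · simp [mulVec_add, A.d_d, mulVec_smul]
          rfl
        · simp [A.d_d, mulVec_neg]
          rfl

/-- An ideal of variables contains f iff every monomial of f involves one of them. Multiplying by a
variable outside `s` does not change the exponents that matter. -/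
theorem X_mul_mem_span_X_iff {s : Set σ} {a : σ} (ha : a ∉ s) {f : MvPolynomial σ k}
    (hf : MvPolynomial.X a * f ∈ Ideal.span (MvPolynomial.X '' s : Set (MvPolynomial σ k))) :
    f ∈ Ideal.span (MvPolynomial.X '' s : Set (MvPolynomial σ k)) := by
  rw [MvPolynomial.mem_ideal_span_X_image] at hf ⊢
  intro m hm
  obtain ⟨i, hi, hne⟩ := hf (Finsupp.single a 1 + m) (by
    rw [MvPolynomial.mem_support_iff, MvPolynomial.coeff_X_mul]
    exact MvPolynomial.mem_support_iff.1 hm)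
  have hia : a ≠ i := fun h => ha (h ▸ hi)
  exact ⟨i, hi, by simpa [Finsupp.single_apply, hia] using hne⟩

/-- The trivial resolution of `S`. -/
noncomputable def trivial (σ : Type) (k : Type u) [Field k] :
    LinearResolution (⊥ : Ideal (MvPolynomial σ k)) 1 (fun i => (0).choose (i + 1)) where
  ι _ := Empty
  card_ι _ := rfl
  ε := Empty.elim
  d _ := 0
  ε_homogeneous p := p.elim
  d_homogeneous _ p := p.elim
  mem_iff f := by
    rw [Ideal.mem_bot]
    exact ⟨fun h => ⟨0, by simp [h]⟩, fun ⟨v, hv⟩ => by rw [← hv]; simp [dotProduct]⟩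
  exact_zero v := ⟨fun _ => ⟨0, Subsingleton.elim _ _⟩, fun _ => by simp [dotProduct]⟩
  exact_succ i v := ⟨fun _ => ⟨0, Subsingleton.elim _ _⟩, fun _ => Subsingleton.elim _ _⟩

/-- The Koszul resolution of an ideal generated by variables. -/
theorem nonempty_koszul (s : Finset σ) :
    Nonempty (LinearResolution (Ideal.span (MvPolynomial.X '' (s : Set σ)) :
      Ideal (MvPolynomial σ k)) 1 (fun i => s.card.choose (i + 1))) := by
  classical
  induction s using Finset.induction_on with
  | empty =>
    rw [Finset.coe_empty, Set.image_empty, Ideal.span_empty, Finset.card_empty]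
    exact ⟨trivial σ k⟩
  | insert a s ha ih =>
    obtain ⟨A⟩ := ih
    rw [Finset.coe_insert, Set.image_insert_eq, Ideal.span_insert, sup_comm,
      Finset.card_insert_of_notMem ha]
    exact ⟨A.cone (MvPolynomial.X a) (MvPolynomial.isHomogeneous_X _ _)
      (fun f => X_mul_mem_span_X_iff (by simpa using ha))⟩

/-! ### Gluing two mapping cones along a shared generator -/

section Hook

variable {J K : Ideal (MvPolynomial σ k)} {r s : ℕ → ℕ} (A : LinearResolution J 1 r)
  (B : LinearResolution K 1 s) (x y : MvPolynomial σ k)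

/-- The index sets of the gluing of two mapping cones along their last generators. -/
def hookIndex (ι κ : ℕ → Type) : ℕ → Type
  | 0 => ι 0 ⊕ (κ 0 ⊕ Unit)
  | i + 1 => coneIndex ι (i + 1) ⊕ coneIndex κ (i + 1)

instance (ι κ : ℕ → Type) [∀ i, Fintype (ι i)] [∀ i, Fintype (κ i)] :
    ∀ i, Fintype (hookIndex ι κ i)
  | 0 => inferInstanceAs (Fintype (ι 0 ⊕ (κ 0 ⊕ Unit)))
  | i + 1 => inferInstanceAs (Fintype (coneIndex ι (i + 1) ⊕ coneIndex κ (i + 1)))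

instance (ι κ : ℕ → Type) [∀ i, DecidableEq (ι i)] [∀ i, DecidableEq (κ i)] :
    ∀ i, DecidableEq (hookIndex ι κ i)
  | 0 => inferInstanceAs (DecidableEq (ι 0 ⊕ (κ 0 ⊕ Unit)))
  | i + 1 => inferInstanceAs (DecidableEq (coneIndex ι (i + 1) ⊕ coneIndex κ (i + 1)))

/-- The generators `x J`, `y K`, `x y`. -/
noncomputable def hookε : hookIndex A.ι B.ι 0 → MvPolynomial σ k :=
  (Sum.elim (x • A.ε) (Sum.elim (y • B.ε) (fun _ => x * y)) : A.ι 0 ⊕ (B.ι 0 ⊕ Unit) → _)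

/-- The differentials of the gluing of the two mapping cones. -/
noncomputable def hookD :
    ∀ i, Matrix (hookIndex A.ι B.ι i) (hookIndex A.ι B.ι (i + 1)) (MvPolynomial σ k)
  | 0 => (of (Sum.elim (fun p => Sum.elim (A.coneD y 0 (Sum.inl p)) 0)
      (Sum.elim (fun p => Sum.elim 0 (B.coneD x 0 (Sum.inl p)))
        -- The row of the shared generator xy joins the row of y in the first cone to the row of x
        -- in the second.
        (fun u => Sum.elim (A.coneD y 0 (Sum.inr u)) (B.coneD x 0 (Sum.inr u))))) :
      Matrix (A.ι 0 ⊕ (B.ι 0 ⊕ Unit)) (coneIndex A.ι 1 ⊕ coneIndex B.ι 1) _)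
  | i + 1 => (fromBlocks (A.coneD y (i + 1)) 0 0 (B.coneD x (i + 1)) :
      Matrix (coneIndex A.ι (i + 1) ⊕ coneIndex B.ι (i + 1))
        (coneIndex A.ι (i + 2) ⊕ coneIndex B.ι (i + 2)) _)

/-- Besides giving that the glued maps compose to zero, this relation recovers the last entry of a
boundary from the others when y is nonzero. -/
theorem coneε_coneD (v : coneIndex A.ι 1 → MvPolynomial σ k) :
    A.ε ⬝ᵥ (fun p => (A.coneD y 0 *ᵥ v) (Sum.inl p)) + y * (A.coneD y 0 *ᵥ v) (Sum.inr ()) = 0 := by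
  obtain ⟨a, b, rfl⟩ := exists_eq_sumElim (v : A.ι 1 ⊕ A.ι 0 → _)
  have h : A.coneD y 0 *ᵥ _ = _ := A.coneD_zero_mulVec y a b
  have h1 : (fun p => (A.coneD y 0 *ᵥ (Sum.elim a b : A.ι 1 ⊕ A.ι 0 → _)) (Sum.inl p)) =
      A.d 0 *ᵥ a + y • b := funext fun p => congrFun h (Sum.inl p)
  have h2 : (A.coneD y 0 *ᵥ (Sum.elim a b : A.ι 1 ⊕ A.ι 0 → _)) (Sum.inr ()) = - (A.ε ⬝ᵥ b) :=
    congrFun h (Sum.inr ())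
  refine (congrArg₂ (fun u t => A.ε ⬝ᵥ u + y * t) h1 h2).trans ?_
  rw [dotProduct_add, A.ε_d, dotProduct_smul, smul_eq_mul]
  ring

theorem hookε_dotProduct (a : A.ι 0 → MvPolynomial σ k) (b : B.ι 0 → MvPolynomial σ k)
    (t : Unit → MvPolynomial σ k) :
    (A.hookε B x y) ⬝ᵥ (Sum.elim a (Sum.elim b t) : A.ι 0 ⊕ (B.ι 0 ⊕ Unit) → _) =
      x * (A.ε ⬝ᵥ a) + y * (B.ε ⬝ᵥ b) + x * y * t () := by
  refine (sumElim_dotProduct_sumElim _ _ _ _).trans ?_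
  rw [sumElim_dotProduct_sumElim, smul_dotProduct, smul_dotProduct]
  simp [dotProduct, add_assoc]

theorem hookD_zero_mulVec (a : coneIndex A.ι 1 → MvPolynomial σ k)
    (b : coneIndex B.ι 1 → MvPolynomial σ k) :
    (A.hookD B x y 0 *ᵥ (Sum.elim a b : coneIndex A.ι 1 ⊕ coneIndex B.ι 1 → _) :
      A.ι 0 ⊕ (B.ι 0 ⊕ Unit) → _) =
      Sum.elim (fun p => (A.coneD y 0 *ᵥ a) (Sum.inl p))
        (Sum.elim (fun p => (B.coneD x 0 *ᵥ b) (Sum.inl p))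
          (fun u => (A.coneD y 0 *ᵥ a) (Sum.inr u) + (B.coneD x 0 *ᵥ b) (Sum.inr u))) := by
  funext p
  obtain p | p | p := p
  · exact (sumElim_dotProduct_sumElim _ _ _ _).trans (by rw [zero_dotProduct, add_zero]; rfl)
  · exact (sumElim_dotProduct_sumElim _ _ _ _).trans (by rw [zero_dotProduct, zero_add]; rfl)
  · exact (sumElim_dotProduct_sumElim _ _ _ _)

theorem hookD_succ_mulVec (i : ℕ) (a : coneIndex A.ι (i + 2) → MvPolynomial σ k)
    (b : coneIndex B.ι (i + 2) → MvPolynomial σ k) :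
    A.hookD B x y (i + 1) *ᵥ (Sum.elim a b : coneIndex A.ι (i + 2) ⊕ coneIndex B.ι (i + 2) → _) =
      (Sum.elim (A.coneD y (i + 1) *ᵥ a) (B.coneD x (i + 1) *ᵥ b) :
        coneIndex A.ι (i + 1) ⊕ coneIndex B.ι (i + 1) → _) := by
  refine (fromBlocks_mulVec _ _ _ _ _).trans ?_
  simp

theorem sumElim_eq_zero_iff {α β M : Type*} [Zero M] {a : α → M} {b : β → M} :
    Sum.elim a b = 0 ↔ a = 0 ∧ b = 0 :=
  ⟨fun h => ⟨funext fun p => congrFun h (Sum.inl p), funext fun p => congrFun h (Sum.inr p)⟩,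
    fun h => by rw [h.1, h.2]; exact Sum.elim_zero_zero⟩

/-- The resolution of `x J + y K + (x y)` obtained by gluing the mapping cones resolving
`J + (y)` and `K + (x)`. -/
noncomputable def hook {p q : ℕ} (A : LinearResolution J 1 (fun i => p.choose (i + 1)))
    (B : LinearResolution K 1 (fun i => q.choose (i + 1))) (hx : x.IsHomogeneous 1)
    (hy : y.IsHomogeneous 1) (hJ : ∀ f, y * f ∈ J → f ∈ J) (hK : ∀ f, x * f ∈ K → f ∈ K)
    (hx0 : x ≠ 0) (hy0 : y ≠ 0) (hxy : ∀ f, x ∣ y * f → x ∣ f)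
    {I : Ideal (MvPolynomial σ k)}
    (hI : ∀ f, f ∈ I ↔ ∃ a ∈ J, ∃ b ∈ K, ∃ t, x * a + y * b + x * y * t = f) :
    LinearResolution I 2 (fun i => (p + 1).choose (i + 1) + (q + 1).choose (i + 1) -
      (if i = 0 then 1 else 0)) where
  ι := hookIndex A.ι B.ι
  card_ι i := by
    cases i with
    | zero =>
      refine Fintype.card_sum.trans ?_
      rw [Fintype.card_sum, A.card_ι, B.card_ι]
      simp
      omega
    | succ i =>
      refine Fintype.card_sum.trans ?_
      exact congrArg₂ _ ((A.cone y hy hJ).card_ι (i + 1)) ((B.cone x hx hK).card_ι (i + 1))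
  ε := A.hookε B x y
  d := A.hookD B x y
  ε_homogeneous := by
    rintro (p | p | p)
    · exact hx.mul (A.ε_homogeneous p)
    · exact hy.mul (B.ε_homogeneous p)
    · exact hx.mul hy
  d_homogeneous i := by
    have hA : ∀ i p q, (A.coneD y i p q).IsHomogeneous 1 := (A.cone y hy hJ).d_homogeneous
    have hB : ∀ i p q, (B.coneD x i p q).IsHomogeneous 1 := (B.cone x hx hK).d_homogeneous
    have h0 := MvPolynomial.isHomogeneous_zero σ k 1
    cases i with
    | zero =>
      rintro (p | p | p) (q | q)
      · exact hA 0 (Sum.inl p) q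
      · exact h0
      · exact h0
      · exact hB 0 (Sum.inl p) q
      · exact hA 0 (Sum.inr p) q
      · exact hB 0 (Sum.inr p) q
    | succ i =>
      rintro (p | p) (q | q)
      · exact hA (i + 1) p q
      · exact h0
      · exact h0
      · exact hB (i + 1) p q
  mem_iff f := by
    rw [hI]
    constructor
    · rintro ⟨a, ha, b, hb, t, rfl⟩
      obtain ⟨v, rfl⟩ := (A.mem_iff a).1 ha
      obtain ⟨w, rfl⟩ := (B.mem_iff b).1 hb
      exact ⟨_, A.hookε_dotProduct B x y v w (fun _ => t)⟩
    · rintro ⟨v, rfl⟩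
      obtain ⟨v, w, rfl⟩ := exists_eq_sumElim (v : A.ι 0 ⊕ (B.ι 0 ⊕ Unit) → _)
      obtain ⟨w, t, rfl⟩ := exists_eq_sumElim w
      exact ⟨_, (A.mem_iff _).2 ⟨v, rfl⟩, _, (B.mem_iff _).2 ⟨w, rfl⟩, t (),
        (A.hookε_dotProduct B x y v w t).symm⟩
  exact_zero v := by
    constructor
    · obtain ⟨a, b, rfl⟩ := exists_eq_sumElim (v : A.ι 0 ⊕ (B.ι 0 ⊕ Unit) → _)
      obtain ⟨b, t, rfl⟩ := exists_eq_sumElim b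
      intro h
      replace h := (A.hookε_dotProduct B x y a b t).symm.trans h
      -- The coefficient t of xy has to be divided between the two cones. Since x divides y (ε_B ·
      -- b), it divides ε_B · b = x c; then t = (t + c) + (-c) makes each part a syzygy of its own
      -- cone.
      obtain ⟨c, hc⟩ := hxy (B.ε ⬝ᵥ b) ⟨-(A.ε ⬝ᵥ a + y * t ()), by linear_combination h⟩
      have h1 : A.ε ⬝ᵥ a + y * (t () + c) = 0 := by
        apply mul_left_cancel₀ hx0
        rw [mul_zero, ← h, hc]
        ring
      obtain ⟨v, hv⟩ := ((A.cone y hy hJ).exact_zero (Sum.elim a (fun _ => t () + c) : _ ⊕ _ → _)).1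
        ((A.coneε_dotProduct y _ _).trans h1)
      obtain ⟨w, hw⟩ := ((B.cone x hx hK).exact_zero (Sum.elim b (fun _ => -c) : _ ⊕ _ → _)).1
        ((B.coneε_dotProduct x _ _).trans (by rw [hc]; ring))
      refine ⟨_, (A.hookD_zero_mulVec B x y v w).trans ?_⟩
      change A.coneD y 0 *ᵥ v = _ at hv
      change B.coneD x 0 *ᵥ w = _ at hw
      rw [hv, hw]
      congr 2
      funext u
      simp
    · rintro ⟨w, rfl⟩
      obtain ⟨v, w, rfl⟩ := exists_eq_sumElim (w : coneIndex A.ι 1 ⊕ coneIndex B.ι 1 → _)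
      refine (congrArg _ (A.hookD_zero_mulVec B x y v w)).trans
        ((A.hookε_dotProduct B x y _ _ _).trans ?_)
      linear_combination x * A.coneε_coneD y v + y * B.coneε_coneD x w
  exact_succ i v := by
    obtain ⟨a, b, rfl⟩ := exists_eq_sumElim
      (v : coneIndex A.ι (i + 1) ⊕ coneIndex B.ι (i + 1) → _)
    have hA : A.coneD y i *ᵥ a = 0 ↔ ∃ w, A.coneD y (i + 1) *ᵥ w = a :=
      (A.cone y hy hJ).exact_succ i a
    have hB : B.coneD x i *ᵥ b = 0 ↔ ∃ w, B.coneD x (i + 1) *ᵥ w = b :=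
      (B.cone x hx hK).exact_succ i b
    -- The kernel splits as a direct sum. This is clear in block diagonal degrees; for i = 0 the
    -- shared row only controls a sum, but each summand vanishes because y, respectively x, times it
    -- is zero.
    have key : A.hookD B x y i *ᵥ (Sum.elim a b : coneIndex A.ι (i + 1) ⊕ coneIndex B.ι (i + 1) → _)
        = 0 ↔ A.coneD y i *ᵥ a = 0 ∧ B.coneD x i *ᵥ b = 0 := by
      cases i with
      | zero =>
        have hv := A.coneε_coneD y a
        have hw := B.coneε_coneD x b
        refine (Eq.congr_left (A.hookD_zero_mulVec B x y a b)).trans ?_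
        refine (sumElim_eq_zero_iff (α := A.ι 0) (β := B.ι 0 ⊕ Unit)).trans ?_
        rw [sumElim_eq_zero_iff]
        constructor
        · rintro ⟨h1, h2, -⟩
          rw [h1, dotProduct_zero, zero_add] at hv
          rw [h2, dotProduct_zero, zero_add] at hw
          constructor
          · funext p
            obtain p | p := p
            · exact congrFun h1 p
            · exact (mul_eq_zero.1 hv).resolve_left hy0
          · funext p
            obtain p | p := p
            · exact congrFun h2 p
            · exact (mul_eq_zero.1 hw).resolve_left hx0
        · rintro ⟨h1, h2⟩
          rw [h1, h2]
          exact ⟨rfl, rfl, funext fun _ => add_zero _⟩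
      | succ i =>
        exact (Eq.congr_left (A.hookD_succ_mulVec B x y i a b)).trans sumElim_eq_zero_iff
    rw [key, hA, hB]
    constructor
    · rintro ⟨⟨v, rfl⟩, ⟨w, rfl⟩⟩
      exact ⟨_, A.hookD_succ_mulVec B x y i v w⟩
    · rintro ⟨w, hw⟩
      obtain ⟨v, w, rfl⟩ := exists_eq_sumElim
        (w : coneIndex A.ι (i + 2) ⊕ coneIndex B.ι (i + 2) → _)
      replace hw := (A.hookD_succ_mulVec B x y i v w).symm.trans hw
      exact ⟨⟨v, funext fun p => congrFun hw (Sum.inl p)⟩,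
        ⟨w, funext fun p => congrFun hw (Sum.inr p)⟩⟩

end Hook

/-! ### From linear resolutions to minimal graded free resolutions -/

variable {I : Ideal (MvPolynomial σ k)} {e : ℕ} {r : ℕ → ℕ} (A : LinearResolution I e r)

/-- The ranks of the free modules of the resolution. -/
def rank (_ : LinearResolution I e r) : ℕ → ℕ
  | 0 => 1
  | i + 1 => r i

/-- The degrees of the basis elements of the resolution. -/
def deg (_ : LinearResolution I e r) : ℕ → ℕ
  | 0 => 0
  | i + 1 => i + e

/-- A numbering of the basis elements. -/
noncomputable def equivFin (i : ℕ) : Fin (r i) ≃ A.ι i :=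
  (Fintype.equivFinOfCardEq (A.card_ι i)).symm

/-- The matrices of the differentials, indexed by numbers. -/
noncomputable def mat : ∀ i, Matrix (Fin (A.rank i)) (Fin (A.rank (i + 1))) (MvPolynomial σ k)
  | 0 => (of fun _ q => A.ε (A.equivFin 0 q) : Matrix (Fin 1) (Fin (r 0)) _)
  | i + 1 => ((A.d i).submatrix (A.equivFin i) (A.equivFin (i + 1)) :
      Matrix (Fin (r i)) (Fin (r (i + 1))) _)

theorem mat_zero_mulVec (v : Fin (r 0) → MvPolynomial σ k) (p : Fin 1) :
    (A.mat 0 *ᵥ v : Fin 1 → _) p = A.ε ⬝ᵥ (v ∘ (A.equivFin 0).symm) := by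
  change ∑ q, A.ε (A.equivFin 0 q) * v q = ∑ q, A.ε q * v ((A.equivFin 0).symm q)
  exact Fintype.sum_equiv (A.equivFin 0) _ _ (fun q => by simp)

theorem mat_succ_mulVec (i : ℕ) (v : Fin (r (i + 1)) → MvPolynomial σ k) :
    (A.mat (i + 1) *ᵥ v : Fin (r i) → _) =
      (A.d i *ᵥ (v ∘ (A.equivFin (i + 1)).symm)) ∘ A.equivFin i :=
  submatrix_mulVec_equiv _ _ _ _

theorem range_mat_succ (i : ℕ) (v : Fin (r i) → MvPolynomial σ k) :
    (∃ w : Fin (r (i + 1)) → MvPolynomial σ k, (A.mat (i + 1) *ᵥ w : Fin (r i) → _) = v) ↔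
      ∃ w, A.d i *ᵥ w = v ∘ (A.equivFin i).symm := by
  constructor
  · rintro ⟨w, rfl⟩
    refine ⟨w ∘ (A.equivFin (i + 1)).symm, ?_⟩
    rw [A.mat_succ_mulVec, Function.comp_assoc, Equiv.self_comp_symm, Function.comp_id]
  · rintro ⟨w, hw⟩
    refine ⟨w ∘ A.equivFin (i + 1), ?_⟩
    rw [A.mat_succ_mulVec, Function.comp_assoc, Equiv.self_comp_symm, Function.comp_id, hw,
      Function.comp_assoc, Equiv.symm_comp_self, Function.comp_id]

theorem range_mat_zero (f : MvPolynomial σ k) :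
    (∃ w : Fin (r 0) → MvPolynomial σ k, (A.mat 0 *ᵥ w : Fin 1 → _) = fun _ => f) ↔ f ∈ I := by
  rw [A.mem_iff]
  constructor
  · rintro ⟨w, hw⟩
    exact ⟨_, (A.mat_zero_mulVec w 0).symm.trans (congrFun hw 0)⟩
  · rintro ⟨w, rfl⟩
    refine ⟨w ∘ A.equivFin 0, funext fun p => ?_⟩
    rw [A.mat_zero_mulVec, Function.comp_assoc, Equiv.self_comp_symm, Function.comp_id]

theorem ker_mat_zero (v : Fin (r 0) → MvPolynomial σ k) :
    (A.mat 0 *ᵥ v : Fin 1 → _) = 0 ↔ A.ε ⬝ᵥ (v ∘ (A.equivFin 0).symm) = 0 :=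
  ⟨fun h => (A.mat_zero_mulVec v 0).symm.trans (congrFun h 0),
    fun h => funext fun p => (A.mat_zero_mulVec v p).trans h⟩

theorem ker_mat_succ (i : ℕ) (v : Fin (r (i + 1)) → MvPolynomial σ k) :
    (A.mat (i + 1) *ᵥ v : Fin (r i) → _) = 0 ↔ A.d i *ᵥ (v ∘ (A.equivFin (i + 1)).symm) = 0 := by
  rw [A.mat_succ_mulVec]
  constructor
  · intro h
    funext p
    simpa using congrFun h ((A.equivFin i).symm p)
  · intro h
    rw [h]
    rfl

theorem mat_homogeneous (i : ℕ) (p : Fin (A.rank i)) (q : Fin (A.rank (i + 1))) :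
    ∃ e', A.deg i + e' = A.deg (i + 1) ∧ (A.mat i p q).IsHomogeneous e' := by
  cases i with
  | zero => exact ⟨e, rfl, A.ε_homogeneous _⟩
  | succ i => exact ⟨1, by simp [deg]; omega, A.d_homogeneous _ _ _⟩

/-- The minimal graded free resolution given by a linear resolution. -/
noncomputable def toMinimal (he : e ≠ 0) : MinimalGradedFreeResolution I where
  rank := A.rank
  deg i _ := A.deg i
  aug := (Ideal.Quotient.mkₐ (MvPolynomial σ k) I).toLinearMap ∘ₗ
    LinearMap.proj (R := MvPolynomial σ k) (φ := fun _ : Fin 1 => MvPolynomial σ k) 0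
  diff i := (A.mat i).mulVecLin
  aug_homogeneous p := by
    obtain rfl : p = (0 : Fin 1) := Subsingleton.elim (α := Fin 1) _ _
    refine ⟨1, MvPolynomial.isHomogeneous_one _ _, ?_⟩
    change _ = Ideal.Quotient.mk I ((Pi.single (0 : Fin 1) 1 : Fin 1 → MvPolynomial σ k) 0)
    simp
  diff_homogeneous i q p := by
    obtain ⟨e', h1, h2⟩ := A.mat_homogeneous i p q
    exact Or.inr ⟨e', h1, by simpa using h2⟩
  aug_surjective z := by
    obtain ⟨f, rfl⟩ := Ideal.Quotient.mk_surjective z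
    exact ⟨fun _ => f, rfl⟩
  exact_zero v := by
    change Ideal.Quotient.mk I (v (0 : Fin 1)) = 0 ↔ ∃ w, A.mat 0 *ᵥ w = v
    rw [Ideal.Quotient.eq_zero_iff_mem, ← A.range_mat_zero]
    have hv : (fun _ : Fin 1 => v (0 : Fin 1)) = v :=
      funext fun p => congrArg v (Subsingleton.elim (α := Fin 1) _ _)
    exact exists_congr fun w => Eq.congr_right hv
  exact_succ i v := by
    cases i with
    | zero =>
      exact (A.ker_mat_zero v).trans ((A.exact_zero _).trans (A.range_mat_succ 0 v).symm)
    | succ i =>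
      exact (A.ker_mat_succ i v).trans ((A.exact_succ i _).trans (A.range_mat_succ (i + 1) v).symm)
  minimal i q p := by
    -- A form of nonzero degree has no constant term; `he` covers the generators, and the later
    -- entries are linear.
    have : A.mat i p q = 0 ∨ ∃ e' ≠ 0, (A.mat i p q).IsHomogeneous e' := by
      cases i with
      | zero => exact Or.inr ⟨e, he, A.ε_homogeneous _⟩
      | succ i => exact Or.inr ⟨1, one_ne_zero, A.d_homogeneous _ _ _⟩
    obtain h | ⟨e', he', h⟩ := this
    · simp [h]
    · simp only [mulVecLin_apply, mulVec_single_one, col_apply]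
      rw [MvPolynomial.constantCoeff_eq]
      exact h.coeff_eq_zero (by simpa using he'.symm)

theorem gradedBetti_zero (he : e ≠ 0) (j : ℕ) :
    (A.toMinimal he).gradedBetti 0 j = if j = 0 then 1 else 0 := by
  change (Finset.univ.filter fun _ : Fin 1 => 0 = j).card = _
  rw [Finset.filter_const]
  obtain rfl | h := eq_or_ne j 0
  · simp
  · simp [h, h.symm]

theorem gradedBetti_succ (he : e ≠ 0) (i j : ℕ) :
    (A.toMinimal he).gradedBetti (i + 1) j = if j = i + e then r i else 0 := by
  change (Finset.univ.filter fun _ : Fin (r i) => i + e = j).card = _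
  rw [Finset.filter_const]
  obtain rfl | h := eq_or_ne j (i + e)
  · simp
  · simp [h, h.symm]

end LinearResolution

/-! ### The hook Ferrers ideal and its resolution -/

/-- The Ferrers ideal of a hook, generated by `x₁ (y₂, …, y_n)`, `y₁ (x₂, …, x_m)` and `x₁ y₁`. -/
theorem mem_ferrersIdeal_hookTableau_iff (k : Type u) [Field k] (m n : ℕ)
    (f : MvPolynomial (Fin (m + 1) ⊕ Fin (n + 1)) k) :
    f ∈ ferrersIdeal k (n + 1) (hookTableau (m + 1) (n + 1)) ↔
      ∃ a ∈ Ideal.span (MvPolynomial.X '' (((Finset.univ.erase (0 : Fin (n + 1))).map Function.Embedding.inr :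
          Finset (Fin (m + 1) ⊕ Fin (n + 1))) :
          Set (Fin (m + 1) ⊕ Fin (n + 1)))),
      ∃ b ∈ Ideal.span (MvPolynomial.X '' (((Finset.univ.erase (0 : Fin (m + 1))).map Function.Embedding.inl :
          Finset (Fin (m + 1) ⊕ Fin (n + 1))) :
          Set (Fin (m + 1) ⊕ Fin (n + 1)))),
      ∃ t, MvPolynomial.X (Sum.inl 0) * a + MvPolynomial.X (Sum.inr 0) * b +
        MvPolynomial.X (Sum.inl 0) * MvPolynomial.X (Sum.inr 0) * t = f := by
  have hI : ferrersIdeal k (n + 1) (hookTableau (m + 1) (n + 1)) =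
      Ideal.span {MvPolynomial.X (Sum.inl 0)} *
        Ideal.span (MvPolynomial.X '' (((Finset.univ.erase (0 : Fin (n + 1))).map Function.Embedding.inr :
          Finset (Fin (m + 1) ⊕ Fin (n + 1))) :
          Set (Fin (m + 1) ⊕ Fin (n + 1)))) ⊔
      Ideal.span {MvPolynomial.X (Sum.inr 0)} *
        Ideal.span (MvPolynomial.X '' (((Finset.univ.erase (0 : Fin (m + 1))).map Function.Embedding.inl :
          Finset (Fin (m + 1) ⊕ Fin (n + 1))) :
          Set (Fin (m + 1) ⊕ Fin (n + 1)))) ⊔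
      Ideal.span {MvPolynomial.X (Sum.inl 0) * MvPolynomial.X (Sum.inr 0)} := by
    rw [Ideal.span_mul_span', Ideal.span_mul_span', ← Ideal.span_union, ← Ideal.span_union,
      ferrersIdeal]
    congr 1
    ext p
    simp only [Set.mem_ofPred_eq, Set.mem_union, Set.singleton_mul, Set.mem_image, Finset.mem_coe,
      Finset.mem_map, Finset.mem_erase, Finset.mem_univ, and_true, Set.mem_singleton_iff,
      Function.Embedding.inr_apply, Function.Embedding.inl_apply, hookTableau]
    constructor
    · rintro ⟨i, j, hij, rfl⟩
      by_cases hi : i = 0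
      · subst hi
        by_cases hj : j = 0
        · subst hj
          exact Or.inr rfl
        · exact Or.inl (Or.inl ⟨_, ⟨_, ⟨j, hj, rfl⟩, rfl⟩, rfl⟩)
      · have hi' : i.val ≠ 0 := fun h => hi (Fin.ext h)
        rw [if_neg hi'] at hij
        obtain rfl : j = 0 := Fin.ext (by simpa using hij)
        exact Or.inl (Or.inr ⟨_, ⟨_, ⟨i, hi, rfl⟩, rfl⟩, mul_comm _ _⟩)
    · rintro ((⟨_, ⟨_, ⟨j, hj, rfl⟩, rfl⟩, rfl⟩ | ⟨_, ⟨_, ⟨i, hi, rfl⟩, rfl⟩, rfl⟩) | rfl)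
      · exact ⟨0, j, j.2, rfl⟩
      · exact ⟨i, 0, by split_ifs <;> simp, mul_comm _ _⟩
      · exact ⟨0, 0, by simp, rfl⟩
  rw [hI, Submodule.mem_sup]
  simp only [Submodule.mem_sup, Ideal.mem_span_singleton_mul, Ideal.mem_span_singleton]
  constructor
  · rintro ⟨_, ⟨_, ⟨a, ha, rfl⟩, _, ⟨b, hb, rfl⟩, rfl⟩, _, ⟨t, rfl⟩, rfl⟩
    exact ⟨a, ha, b, hb, t, rfl⟩
  · rintro ⟨a, ha, b, hb, t, rfl⟩
    exact ⟨_, ⟨_, ⟨a, ha, rfl⟩, _, ⟨b, hb, rfl⟩, rfl⟩, _, ⟨t, rfl⟩, rfl⟩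

/-- The Ferrers ideal of a hook has a `2`-linear resolution. -/
theorem nonempty_linearResolution_hook (k : Type u) [Field k] (m n : ℕ) :
    Nonempty (LinearResolution (ferrersIdeal k (n + 1) (hookTableau (m + 1) (n + 1))) 2
      (fun i => (n + 1).choose (i + 1) + (m + 1).choose (i + 1) - (if i = 0 then 1 else 0))) := by
  obtain ⟨A⟩ := LinearResolution.nonempty_koszul (k := k)
    ((Finset.univ.erase 0).map Function.Embedding.inr : Finset (Fin (m + 1) ⊕ Fin (n + 1)))
  obtain ⟨B⟩ := LinearResolution.nonempty_koszul (k := k)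
    ((Finset.univ.erase 0).map Function.Embedding.inl : Finset (Fin (m + 1) ⊕ Fin (n + 1)))
  have hA : ((Finset.univ.erase 0).map Function.Embedding.inr :
      Finset (Fin (m + 1) ⊕ Fin (n + 1))).card = n := by simp
  have hB : ((Finset.univ.erase 0).map Function.Embedding.inl :
      Finset (Fin (m + 1) ⊕ Fin (n + 1))).card = m := by simp
  rw [hA] at A
  rw [hB] at B
  refine ⟨LinearResolution.hook (MvPolynomial.X (Sum.inl 0)) (MvPolynomial.X (Sum.inr 0)) A B
    (MvPolynomial.isHomogeneous_X _ _) (MvPolynomial.isHomogeneous_X _ _)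
    (fun f => LinearResolution.X_mul_mem_span_X_iff (by simp))
    (fun f => LinearResolution.X_mul_mem_span_X_iff (by simp))
    (MvPolynomial.X_ne_zero _) (MvPolynomial.X_ne_zero _) (fun f hf => ?_)
    (mem_ferrersIdeal_hookTableau_iff k m n)⟩
  -- x_1 is prime and does not divide the different variable y_1.
  refine ((MvPolynomial.X_prime).dvd_or_dvd hf).resolve_left fun h => ?_
  simpa using MvPolynomial.X_dvd_X.1 h

end LinearResolution

/-! ### The Hilbert series by counting monomials -/

section HilbertSeries

variable {σ : Type} {k : Type u} [Field k]

/-- The Hilbert function of a monomial ideal counts the monomials outside of the ideal. -/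
theorem finrank_quotientPiece_monomial [Fintype σ] [DecidableEq σ] (T : Set (σ →₀ ℕ))
    (F : Finset (σ →₀ ℕ)) (d : ℕ) (hF : ∀ e, e ∈ F ↔ e.degree = d ∧ ∀ t ∈ T, ¬ t ≤ e) :
    Module.finrank k (quotientPiece (Ideal.span ((fun e => MvPolynomial.monomial e (1 : k)) '' T)) d)
      = F.card := by
  set I := Ideal.span ((fun e => MvPolynomial.monomial e (1 : k)) '' T) with hI
  let b : F → MvPolynomial σ k ⧸ I := fun e => Ideal.Quotient.mkₐ k I (MvPolynomial.monomial e 1)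
  have hli : LinearIndependent k b := by
    rw [Fintype.linearIndependent_iff]
    intro g hg e
    by_contra hne
    -- A vanishing combination of classes lifts to a polynomial in I. Since I is a monomial ideal,
    -- each monomial occurring in it is divisible by a generator, which `F` excludes.
    have hmem : ∑ e : F, MvPolynomial.monomial (e : σ →₀ ℕ) (g e) ∈ I := by
      rw [← Ideal.Quotient.eq_zero_iff_mem, ← Ideal.Quotient.mkₐ_eq_mk k, map_sum, ← hg]
      refine Finset.sum_congr rfl fun e _ => ?_
      rw [← map_smul, MvPolynomial.smul_monomial, smul_eq_mul, mul_one]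
    rw [hI, MvPolynomial.mem_ideal_span_monomial_image] at hmem
    obtain ⟨t, ht, hte⟩ := hmem e (by
      rw [MvPolynomial.mem_support_iff, MvPolynomial.coeff_sum, Finset.sum_eq_single e]
      · simpa using hne
      · intro e' _ he'
        rw [MvPolynomial.coeff_monomial, if_neg (fun h => he' (Subtype.ext h))]
      · simp)
    exact ((hF e).1 e.2).2 t ht hte
  have hspan : quotientPiece I d = Submodule.span k (Set.range b) := by
    apply le_antisymm
    · rintro _ ⟨f, hf, rfl⟩
      rw [MvPolynomial.as_sum f, map_sum]
      refine Submodule.sum_mem _ fun e he => ?_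
      have hdeg : e.degree = d := by
        have := hf (MvPolynomial.mem_support_iff.1 he)
        rwa [Finsupp.degree_eq_weight_one]
      -- A monomial of degree d is either one of those in `F` or zero in the quotient.
      by_cases heT : ∀ t ∈ T, ¬ t ≤ e
      · have : MvPolynomial.monomial e (f.coeff e) = f.coeff e • MvPolynomial.monomial e (1 : k) := by
          simp [MvPolynomial.smul_monomial]
        rw [this, map_smul]
        exact Submodule.smul_mem _ _ (Submodule.subset_span ⟨⟨e, (hF e).2 ⟨hdeg, heT⟩⟩, rfl⟩)
      · push Not at heT
        obtain ⟨t, ht, hte⟩ := heT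
        convert Submodule.zero_mem _
        change Ideal.Quotient.mk I _ = 0
        rw [Ideal.Quotient.eq_zero_iff_mem, hI, MvPolynomial.mem_ideal_span_monomial_image]
        intro e' he'
        rw [Finset.mem_singleton.1 (MvPolynomial.support_monomial_subset he')]
        exact ⟨t, ht, hte⟩
    · rw [Submodule.span_le]
      rintro _ ⟨e, rfl⟩
      exact ⟨_, MvPolynomial.isHomogeneous_monomial _ ((hF e).1 e.2).1, rfl⟩
  rw [hspan, finrank_span_eq_card hli, Fintype.card_coe]

/-- `1 / (1 - t)^s` counts the monomials in `s` variables. -/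
theorem coeff_inv_one_sub_pow_card [DecidableEq σ] (s : Finset σ) (d : ℕ) :
    PowerSeries.coeff d ((1 - PowerSeries.X : PowerSeries ℚ) ^ s.card)⁻¹ =
      ((s.finsuppAntidiag d).card : ℚ) := by
  rw [Finset.card_finsuppAntidiag_nat_eq_multichoose]
  generalize s.card = N
  have h : ((1 - PowerSeries.X : PowerSeries ℚ) ^ N)⁻¹ =
      (PowerSeries.invOneSubPow ℚ N : PowerSeries ℚ) := by
    symm
    rw [PowerSeries.eq_inv_iff_mul_eq_one (by simp), ← PowerSeries.invOneSubPow_inv_eq_one_sub_pow]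
    exact Units.mul_inv _
  rw [h]
  cases N with
  | zero =>
    rw [PowerSeries.invOneSubPow_zero, Units.val_one, PowerSeries.coeff_one]
    cases d <;> simp
  | succ N =>
    rw [PowerSeries.invOneSubPow_val_succ_eq_mk_add_choose, PowerSeries.coeff_mk,
      Nat.multichoose_eq, Nat.choose_symm_of_eq_add (n := N + d) (a := N) (b := d) rfl]
    congr 2
    omega

theorem ferrersIdeal_eq_span_monomial (k : Type u) [Field k] {m : ℕ} (n : ℕ) (lam : Fin m → ℕ) :
    ferrersIdeal k n lam = Ideal.span ((fun e => MvPolynomial.monomial e (1 : k)) ''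
      {t | ∃ (i : Fin m) (j : Fin n), j.val < lam i ∧
        t = Finsupp.single (Sum.inl i) 1 + Finsupp.single (Sum.inr j) 1}) := by
  rw [ferrersIdeal]
  congr 1
  ext p
  constructor
  · rintro ⟨i, j, hij, rfl⟩
    exact ⟨_, ⟨i, j, hij, rfl⟩, by simp [MvPolynomial.X, MvPolynomial.monomial_mul]⟩
  · rintro ⟨_, ⟨i, j, hij, rfl⟩, rfl⟩
    exact ⟨i, j, hij, by simp [MvPolynomial.X, MvPolynomial.monomial_mul]⟩

theorem not_single_add_single_le_iff {a b : σ} (hab : a ≠ b) (e : σ →₀ ℕ) :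
    ¬ (Finsupp.single a 1 + Finsupp.single b 1 ≤ e) ↔ e a = 0 ∨ e b = 0 := by
  classical
  rw [Finsupp.le_def]
  constructor
  · intro h
    by_contra! h0
    apply h
    intro i
    simp only [Finsupp.add_apply, Finsupp.single_apply]
    split_ifs with h1 h2 h2
    · exact absurd (h1.trans h2.symm) hab
    · subst h1; omega
    · subst h2; omega
    · omega
  · intro h h0
    have ha := h0 a
    have hb := h0 b
    simp [hab, hab.symm] at ha hb
    omega

theorem mem_finsuppAntidiag_iff_degree [Fintype σ] [DecidableEq σ] (s : Finset σ) (d : ℕ)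
    (e : σ →₀ ℕ) : e ∈ s.finsuppAntidiag d ↔ e.degree = d ∧ ∀ a ∉ s, e a = 0 := by
  rw [Finset.mem_finsuppAntidiag']
  refine and_congr Iff.rfl ?_
  constructor
  · intro h a ha
    by_contra h0
    exact ha (h (Finsupp.mem_support_iff.2 h0))
  · intro h a ha
    by_contra h0
    exact Finsupp.mem_support_iff.1 ha (h a h0)

/-- Here `D` fixes the degree, `x` and `y` say that x_1 and y_1 are absent, and `X` and `Y` that all
x_i, respectively all y_j, are absent. The right side is membership in the complement of I; the left
side is its partition according to which of x_1, y_1 occurs. -/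
theorem hook_monomial_cases {D x y X Y : Prop} (hx : X → x) (hy : Y → y) :
    (D ∧ x ∧ y) ∨ ((D ∧ Y) ∧ ¬ (D ∧ x ∧ Y)) ∨ ((D ∧ X) ∧ ¬ (D ∧ y ∧ X)) ↔
      D ∧ (x ∨ Y) ∧ (X ∨ y) := by
  tauto

theorem hilbertSeries_hook (k : Type u) [Field k] (m n : ℕ) :
    hilbertSeries (ferrersIdeal k (n + 1) (hookTableau (m + 1) (n + 1))) =
        ((1 - PowerSeries.X : PowerSeries ℚ) ^ (n + 1))⁻¹
          + ((1 - PowerSeries.X : PowerSeries ℚ) ^ (m + 1))⁻¹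
          + ((1 - PowerSeries.X : PowerSeries ℚ) ^ (m + n))⁻¹
          - ((1 - PowerSeries.X : PowerSeries ℚ) ^ n)⁻¹
          - ((1 - PowerSeries.X : PowerSeries ℚ) ^ m)⁻¹ := by
  let ix : Fin (m + 1) ↪ Fin (m + 1) ⊕ Fin (n + 1) := Function.Embedding.inl
  let iy : Fin (n + 1) ↪ Fin (m + 1) ⊕ Fin (n + 1) := Function.Embedding.inr
  let B := Finset.univ.map ix
  let B' := (Finset.univ.erase 0).map ix
  let C := Finset.univ.map iy
  let C' := (Finset.univ.erase 0).map iy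
  have hdisj : Disjoint B' C' := by
    rw [Finset.disjoint_left]
    simp [B', C', ix, iy]
  have hB : B.card = m + 1 := by simp [B]
  have hB' : B'.card = m := by simp [B']
  have hC : C.card = n + 1 := by simp [C]
  have hC' : C'.card = n := by simp [C']
  have hA : (B' ∪ C').card = m + n := by rw [Finset.card_union_of_disjoint hdisj, hB', hC']
  ext d
  have cB := coeff_inv_one_sub_pow_card B d
  have cB' := coeff_inv_one_sub_pow_card B' d
  have cC := coeff_inv_one_sub_pow_card C d
  have cC' := coeff_inv_one_sub_pow_card C' d
  have cA := coeff_inv_one_sub_pow_card (B' ∪ C') d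
  rw [hB] at cB
  rw [hB'] at cB'
  rw [hC] at cC
  rw [hC'] at cC'
  rw [hA] at cA
  simp only [map_add, map_sub, cA, cB, cB', cC, cC']
  have mB : ∀ a, a ∉ B ↔ ∃ j, a = Sum.inr j := by rintro (i | j) <;> simp [B, ix]
  have mB' : ∀ a, a ∉ B' ↔ a = Sum.inl 0 ∨ ∃ j, a = Sum.inr j := by
    rintro (i | j) <;> simp [B', ix]
  have mC : ∀ a, a ∉ C ↔ ∃ i, a = Sum.inl i := by rintro (i | j) <;> simp [C, iy]
  have mC' : ∀ a, a ∉ C' ↔ a = Sum.inr 0 ∨ ∃ i, a = Sum.inl i := by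
    rintro (i | j) <;> simp [C', iy]
  have mA : ∀ a, a ∉ B' ∪ C' ↔ a = Sum.inl 0 ∨ a = Sum.inr 0 := by
    rintro (i | j) <;> simp [B', C', ix, iy]
  have eB : ∀ e, e ∈ B.finsuppAntidiag d ↔ e.degree = d ∧ ∀ j, e (Sum.inr j) = 0 := by
    intro e; simp only [mem_finsuppAntidiag_iff_degree, mB]; simp
  have eB' : ∀ e, e ∈ B'.finsuppAntidiag d ↔
      e.degree = d ∧ e (Sum.inl 0) = 0 ∧ ∀ j, e (Sum.inr j) = 0 := by
    intro e; simp only [mem_finsuppAntidiag_iff_degree, mB']; simp [or_imp, forall_and]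
  have eC : ∀ e, e ∈ C.finsuppAntidiag d ↔ e.degree = d ∧ ∀ i, e (Sum.inl i) = 0 := by
    intro e; simp only [mem_finsuppAntidiag_iff_degree, mC]; simp
  have eC' : ∀ e, e ∈ C'.finsuppAntidiag d ↔
      e.degree = d ∧ e (Sum.inr 0) = 0 ∧ ∀ i, e (Sum.inl i) = 0 := by
    intro e; simp only [mem_finsuppAntidiag_iff_degree, mC']; simp [or_imp, forall_and]
  have eA : ∀ e, e ∈ (B' ∪ C').finsuppAntidiag d ↔
      e.degree = d ∧ e (Sum.inl 0) = 0 ∧ e (Sum.inr 0) = 0 := by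
    intro e; simp only [mem_finsuppAntidiag_iff_degree, mA]; simp [or_imp, forall_and]
  have sB : B'.finsuppAntidiag d ⊆ B.finsuppAntidiag d := fun e => by
    rw [eB, eB']; exact fun h => ⟨h.1, h.2.2⟩
  have sC : C'.finsuppAntidiag d ⊆ C.finsuppAntidiag d := fun e => by
    rw [eC, eC']; exact fun h => ⟨h.1, h.2.2⟩
  have d1 : Disjoint (B.finsuppAntidiag d \ B'.finsuppAntidiag d)
      (C.finsuppAntidiag d \ C'.finsuppAntidiag d) := by
    rw [Finset.disjoint_left]
    intro e he he'
    rw [Finset.mem_sdiff, eB, eB'] at he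
    rw [Finset.mem_sdiff, eC] at he'
    exact he.2 ⟨he.1.1, he'.1.2 0, he.1.2⟩
  have d2 : Disjoint ((B' ∪ C').finsuppAntidiag d)
      ((B.finsuppAntidiag d \ B'.finsuppAntidiag d) ∪
        (C.finsuppAntidiag d \ C'.finsuppAntidiag d)) := by
    rw [Finset.disjoint_left]
    intro e he he'
    rw [eA] at he
    rw [Finset.mem_union, Finset.mem_sdiff, Finset.mem_sdiff, eB, eB', eC, eC'] at he'
    obtain h | h := he'
    · exact h.2 ⟨he.1, he.2.1, h.1.2⟩
    · exact h.2 ⟨he.1, he.2.2, h.1.2⟩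
  -- The three disjoint classes: neither x_1 nor y_1; only x variables, with x_1 present; only y
  -- variables, with y_1 present. The differences of sets account for the two negative terms.
  rw [hilbertSeries, PowerSeries.coeff_mk, ferrersIdeal_eq_span_monomial,
    finrank_quotientPiece_monomial _ ((B' ∪ C').finsuppAntidiag d ∪
      ((B.finsuppAntidiag d \ B'.finsuppAntidiag d) ∪
        (C.finsuppAntidiag d \ C'.finsuppAntidiag d))), Finset.card_union_of_disjoint d2,
    Finset.card_union_of_disjoint d1]
  · push_cast [Finset.cast_card_sdiff sB, Finset.cast_card_sdiff sC]
    ring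
  · intro e
    have hT : (∀ t ∈ {t : Fin (m + 1) ⊕ Fin (n + 1) →₀ ℕ | ∃ (i : Fin (m + 1)) (j : Fin (n + 1)),
        j.val < hookTableau (m + 1) (n + 1) i ∧
        t = Finsupp.single (Sum.inl i) 1 + Finsupp.single (Sum.inr j) 1}, ¬ t ≤ e) ↔
        (∀ j, e (Sum.inl 0) = 0 ∨ e (Sum.inr j) = 0) ∧
          ∀ i, e (Sum.inl i) = 0 ∨ e (Sum.inr 0) = 0 := by
      constructor
      · intro h
        refine ⟨fun j => (not_single_add_single_le_iff (by simp) e).1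
          (h _ ⟨0, j, j.2, rfl⟩), fun i => (not_single_add_single_le_iff (by simp) e).1
          (h _ ⟨i, 0, ?_, rfl⟩)⟩
        rw [hookTableau]
        split_ifs <;> simp
      · rintro ⟨h1, h2⟩ t ⟨i, j, hij, rfl⟩
        rw [not_single_add_single_le_iff (by simp)]
        by_cases hi : i.val = 0
        · obtain rfl : i = 0 := Fin.ext hi
          exact h1 j
        · rw [hookTableau, if_neg hi] at hij
          obtain rfl : j = 0 := Fin.ext (by simpa using hij)
          exact h2 i
    rw [hT]
    simp only [Finset.mem_union, Finset.mem_sdiff, eA, eB, eB', eC, eC']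
    rw [forall_or_left, forall_or_right]
    have hx : (∀ i, e (Sum.inl i) = 0) → e (Sum.inl 0) = 0 := fun h => h 0
    have hy : (∀ j, e (Sum.inr j) = 0) → e (Sum.inr 0) = 0 := fun h => h 0
    exact hook_monomial_cases hx hy

end HilbertSeries

/-! ### The main theorem -/

theorem mainTheorem7 (k : Type u) [Field k] (m n : ℕ) (hm : 1 ≤ m) (hn : 1 ≤ n) :
    hilbertSeries (ferrersIdeal k n (hookTableau m n)) =
        ((1 - PowerSeries.X : PowerSeries ℚ) ^ n)⁻¹
          + ((1 - PowerSeries.X : PowerSeries ℚ) ^ m)⁻¹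
          + ((1 - PowerSeries.X : PowerSeries ℚ) ^ (m + n - 2))⁻¹
          - ((1 - PowerSeries.X : PowerSeries ℚ) ^ (n - 1))⁻¹
          - ((1 - PowerSeries.X : PowerSeries ℚ) ^ (m - 1))⁻¹ ∧
    (∀ i : ℕ, 1 ≤ i →
      Module.Finite k (torSpace (ferrersIdeal k n (hookTableau m n)) i) ∧
      (bettiNumber (ferrersIdeal k n (hookTableau m n)) i : ℤ) =
        ((n + 1).choose (i + 1) : ℤ) + ((m + 1).choose (i + 1) : ℤ)
          - (n.choose (i + 1) : ℤ) - (m.choose (i + 1) : ℤ) - (Nat.choose 2 (i + 1) : ℤ)) ∧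
    (∃ F : MinimalGradedFreeResolution (ferrersIdeal k n (hookTableau m n)),
      (∀ j : ℕ, F.gradedBetti 0 j = if j = 0 then 1 else 0) ∧
      ∀ i j : ℕ, 1 ≤ i →
        (F.gradedBetti i j : ℤ) =
          if j = i + 1 then
            ((n + 1).choose (i + 1) : ℤ) + ((m + 1).choose (i + 1) : ℤ)
              - (n.choose (i + 1) : ℤ) - (m.choose (i + 1) : ℤ) - (Nat.choose 2 (i + 1) : ℤ)
          else 0) := by
  obtain ⟨m, rfl⟩ := Nat.exists_eq_add_of_le' hm
  obtain ⟨n, rfl⟩ := Nat.exists_eq_add_of_le' hn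
  obtain ⟨A⟩ := nonempty_linearResolution_hook k m n
  -- Pascal's rule, with homological degree i + 1. The natural subtraction does not truncate, as the
  -- sum is positive at i = 0; binom(2, i + 2) is 1 there and 0 afterwards.
  have hr : ∀ i : ℕ, (((n + 1).choose (i + 1) + (m + 1).choose (i + 1) -
      (if i = 0 then 1 else 0) : ℕ) : ℤ) =
      ((n + 1 + 1).choose (i + 1 + 1) : ℤ) + ((m + 1 + 1).choose (i + 1 + 1) : ℤ)
        - ((n + 1).choose (i + 1 + 1) : ℤ) - ((m + 1).choose (i + 1 + 1) : ℤ)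
        - (Nat.choose 2 (i + 1 + 1) : ℤ) := by
    intro i
    rw [Nat.choose_succ_succ (n + 1) (i + 1), Nat.choose_succ_succ (m + 1) (i + 1)]
    cases i with
    | zero => simp; omega
    | succ i =>
      rw [Nat.choose_eq_zero_of_lt (by omega : 2 < i + 1 + 1 + 1)]
      push_cast
      simp
      ring
  refine ⟨?_, ?_, A.toMinimal two_ne_zero, A.gradedBetti_zero two_ne_zero, ?_⟩
  · rw [hilbertSeries_hook, show m + 1 + (n + 1) - 2 = m + n by omega, Nat.add_sub_cancel,
      Nat.add_sub_cancel]
  · intro i hi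
    obtain ⟨i, rfl⟩ := Nat.exists_eq_add_of_le' hi
    refine ⟨(A.toMinimal two_ne_zero).finite_torSpace _, ?_⟩
    rw [(A.toMinimal two_ne_zero).bettiNumber_eq, ← hr i]
    rfl
  · intro i j hi
    obtain ⟨i, rfl⟩ := Nat.exists_eq_add_of_le' hi
    rw [A.gradedBetti_succ, ← hr i]
    split_ifs <;> rfl
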